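/- Let $\Omega=(0,1)^d$, let $H^1_0(\Omega)$ be the closure in $H^1(\Omega)$ of the smooth functions on $\overline\Omega$ that vanish on $\partial\Omega$, with the norm $\|v\|_{H^1_0(\Omega)}:=\|\,|\nabla v|\,\|_{L_2(\Omega)}$, and let $H^{-1}(\Omega)$ be its dual space with the dual norm. All functions are real-valued, and a function $f$ on $\Omega$ is identified with the functional $v\mapsto\int_\Omega f v$ on $H^1_0(\Omega)$ (when these integrals converge absolutely and define a bounded functional). (a) Let $d\ge 3$ and $\gamma=\frac{2d}{d+2}$. Then $L_\gamma(\Omega)$ is (injectively and continuously) embedded into $H^{-1}(\Omega)$, and $$\|f\|_{H^{-1}(\Omega)}\le C\,\|f\|_{L_\gamma(\Omega)},\qquad f\in L_\gamma(\Omega),$$ with $C$ depending only on $d$. (b) Let $d=2$. Then for every $1<\tau\le\infty$ the space $L_\tau(\Omega)$ is (injectively and continuously) embedded into $H^{-1}(\Omega)$, and $$\|f\|_{H^{-1}(\Omega)}\le C\,\frac{\tau}{\tau-1}\,\|f\|_{L_\tau(\Omega)},\qquad f\in L_\tau(\Omega),$$ where $C$ is an absolute constant, and $\frac{\tau}{\tau-1}$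 is read as $1$ for $\tau=\infty$. -/

import Mathlib

open MeasureTheory
open scoped ENNReal ContDiff

noncomputable section

namespace NegSobolev

variable {d : ℕ}

/-- The open unit cube `(0,1)^d` in Euclidean space. -/
def unitCube (d : ℕ) : Set (EuclideanSpace ℝ (Fin d)) :=
  {x | ∀ i, 0 < x i ∧ x i < 1}

/-- The real space `L_p(Ω)` with respect to Lebesgue measure on `Ω`. -/
abbrev LSpace (Ω : Set (EuclideanSpace ℝ (Fin d))) (p : ℝ≥0∞) : Type :=
  Lp ℝ p ((volume : Measure (EuclideanSpace ℝ (Fin d))).restrict Ω)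

/-- The ambient Hilbert space `L_2(Ω) × L_2(Ω; ℝ^d)` of pairs `(u, g)`, with the norm
`(‖u‖² + ‖g‖²)^{1/2}`. -/
abbrev PairSpace (Ω : Set (EuclideanSpace ℝ (Fin d))) : Type :=
  WithLp 2 (LSpace Ω 2 ×
    Lp (EuclideanSpace ℝ (Fin d)) 2
      ((volume : Measure (EuclideanSpace ℝ (Fin d))).restrict Ω))

/-- `g` is the weak gradient of `u` on the open set `Ω`:
`∫_Ω u ∂ᵢφ = - ∫_Ω gᵢ φ` for every test function `φ ∈ C_c^∞(Ω)` and every `i`. -/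
def IsWeakGradient (Ω : Set (EuclideanSpace ℝ (Fin d)))
    (u : EuclideanSpace ℝ (Fin d) → ℝ)
    (g : EuclideanSpace ℝ (Fin d) → EuclideanSpace ℝ (Fin d)) : Prop :=
  ∀ φ : EuclideanSpace ℝ (Fin d) → ℝ, ContDiff ℝ ∞ φ → HasCompactSupport φ →
    tsupport φ ⊆ Ω → ∀ i : Fin d,
      ∫ x in Ω, u x * fderiv ℝ φ x (EuclideanSpace.single i 1) = - ∫ x in Ω, g x i * φ x

/-- A compactly supported continuous function is a legitimate multiplier of `L_2` functions. -/
theorem integrable_mul_test {μ : Measure (EuclideanSpace ℝ (Fin d))}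
    [IsFiniteMeasureOnCompacts μ]
    {u ψ : EuclideanSpace ℝ (Fin d) → ℝ} (hu : MemLp u 2 μ) (hψ : Continuous ψ)
    (hc : HasCompactSupport ψ) : Integrable (fun x => u x * ψ x) μ :=
  hu.integrable_mul (hψ.memLp_of_hasCompactSupport (p := 2) hc)

theorem memLp_coord {μ : Measure (EuclideanSpace ℝ (Fin d))}
    {g : EuclideanSpace ℝ (Fin d) → EuclideanSpace ℝ (Fin d)} (hg : MemLp g 2 μ) (i : Fin d) :
    MemLp (fun x => g x i) 2 μ :=
  (EuclideanSpace.proj (𝕜 := ℝ) i : EuclideanSpace ℝ (Fin d) →L[ℝ] ℝ).comp_memLp' hg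

theorem test_deriv {φ : EuclideanSpace ℝ (Fin d) → ℝ} (hφ : ContDiff ℝ ∞ φ)
    (hc : HasCompactSupport φ) (i : Fin d) :
    Continuous (fun x => fderiv ℝ φ x (EuclideanSpace.single i 1)) ∧
      HasCompactSupport (fun x => fderiv ℝ φ x (EuclideanSpace.single i 1)) :=
  ⟨(hφ.continuous_fderiv (by simp)).clm_apply continuous_const, hc.fderiv_apply (𝕜 := ℝ) _⟩

/-- The Sobolev space `H¹(Ω)`: the pairs `(u, ∇u)` with `u ∈ L_2(Ω)` having a weak gradient
`∇u ∈ L_2(Ω; ℝ^d)`, with the norm `(‖u‖² + ‖∇u‖²)^{1/2}`.  (The weak gradient is determined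
by `u`.) -/
def H1 (Ω : Set (EuclideanSpace ℝ (Fin d))) : Submodule ℝ (PairSpace Ω) where
  carrier := {v | IsWeakGradient Ω v.fst v.snd}
  zero_mem' := by
    intro φ _ _ _ i
    have h1 : ∀ᵐ x ∂((volume : Measure (EuclideanSpace ℝ (Fin d))).restrict Ω),
        (0 : PairSpace Ω).fst x * fderiv ℝ φ x (EuclideanSpace.single i 1) = 0 := by
      filter_upwards [Lp.coeFn_zero ℝ 2
        ((volume : Measure (EuclideanSpace ℝ (Fin d))).restrict Ω)] with x hx
      have : (0 : PairSpace Ω).fst x = 0 := hx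
      rw [this, zero_mul]
    have h2 : ∀ᵐ x ∂((volume : Measure (EuclideanSpace ℝ (Fin d))).restrict Ω),
        (0 : PairSpace Ω).snd x i * φ x = 0 := by
      filter_upwards [Lp.coeFn_zero (EuclideanSpace ℝ (Fin d)) 2
        ((volume : Measure (EuclideanSpace ℝ (Fin d))).restrict Ω)] with x hx
      have : (0 : PairSpace Ω).snd x = 0 := hx
      rw [this]
      simp
    rw [integral_eq_zero_of_ae h1, integral_eq_zero_of_ae h2, neg_zero]
  add_mem' := by
    intro v w hv hw φ hφ hc hs i
    obtain ⟨h1, h2⟩ := test_deriv hφ hc i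
    have e1 : ∫ x in Ω, (v + w).fst x * fderiv ℝ φ x (EuclideanSpace.single i 1)
        = ∫ x in Ω, (v.fst x * fderiv ℝ φ x (EuclideanSpace.single i 1)
          + w.fst x * fderiv ℝ φ x (EuclideanSpace.single i 1)) := by
      refine integral_congr_ae ?_
      filter_upwards [Lp.coeFn_add v.fst w.fst] with x hx
      have : (v + w).fst x = v.fst x + w.fst x := hx
      rw [this, add_mul]
    have e2 : ∫ x in Ω, (v + w).snd x i * φ x
        = ∫ x in Ω, (v.snd x i * φ x + w.snd x i * φ x) := by
      refine integral_congr_ae ?_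
      filter_upwards [Lp.coeFn_add v.snd w.snd] with x hx
      have : (v + w).snd x = v.snd x + w.snd x := hx
      rw [this, PiLp.add_apply, add_mul]
    rw [e1, e2, integral_add (integrable_mul_test (Lp.memLp _) h1 h2)
        (integrable_mul_test (Lp.memLp _) h1 h2),
      integral_add (integrable_mul_test (memLp_coord (Lp.memLp _) i) hφ.continuous hc)
        (integrable_mul_test (memLp_coord (Lp.memLp _) i) hφ.continuous hc),
      hv φ hφ hc hs i, hw φ hφ hc hs i]
    ring
  smul_mem' := by
    intro c v hv φ hφ hc hs i
    have e1 : ∫ x in Ω, (c • v).fst x * fderiv ℝ φ x (EuclideanSpace.single i 1)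
        = ∫ x in Ω, c * (v.fst x * fderiv ℝ φ x (EuclideanSpace.single i 1)) := by
      refine integral_congr_ae ?_
      filter_upwards [Lp.coeFn_smul c v.fst] with x hx
      have : (c • v).fst x = c * v.fst x := hx
      rw [this, mul_assoc]
    have e2 : ∫ x in Ω, (c • v).snd x i * φ x = ∫ x in Ω, c * (v.snd x i * φ x) := by
      refine integral_congr_ae ?_
      filter_upwards [Lp.coeFn_smul c v.snd] with x hx
      have : (c • v).snd x = c • v.snd x := hx
      rw [this, PiLp.smul_apply, smul_eq_mul, mul_assoc]
    rw [e1, e2, integral_const_mul, integral_const_mul, hv φ hφ hc hs i]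
    ring

/-- The elements `(φ, ∇φ)` of `H¹(Ω)` given by smooth functions `φ` on the closure of `Ω` that
are identically zero on `∂Ω`. -/
def smoothZeroBoundary (Ω : Set (EuclideanSpace ℝ (Fin d))) : Submodule ℝ (H1 Ω) where
  carrier := {v | ∃ φ : EuclideanSpace ℝ (Fin d) → ℝ, ContDiff ℝ ∞ φ ∧
    (∀ x ∈ frontier Ω, φ x = 0) ∧
    (v : PairSpace Ω).fst =ᵐ[(volume : Measure (EuclideanSpace ℝ (Fin d))).restrict Ω] φ ∧
    (v : PairSpace Ω).snd
      =ᵐ[(volume : Measure (EuclideanSpace ℝ (Fin d))).restrict Ω] gradient φ}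
  zero_mem' := by
    refine ⟨fun _ => 0, contDiff_const, fun _ _ => rfl, Lp.coeFn_zero _ _ _, ?_⟩
    refine (Lp.coeFn_zero (EuclideanSpace ℝ (Fin d)) 2
      ((volume : Measure (EuclideanSpace ℝ (Fin d))).restrict Ω)).trans ?_
    refine Filter.Eventually.of_forall fun x => ?_
    simp [gradient]
  add_mem' := by
    rintro v w ⟨φ, hφ, h0, h1, h2⟩ ⟨ψ, hψ, k0, k1, k2⟩
    refine ⟨fun x => φ x + ψ x, hφ.add hψ, fun x hx => by simp [h0 x hx, k0 x hx], ?_, ?_⟩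
    · filter_upwards [Lp.coeFn_add (v : PairSpace Ω).fst (w : PairSpace Ω).fst, h1, k1]
        with x hx h k
      have : ((v + w : H1 Ω) : PairSpace Ω).fst x
        = (v : PairSpace Ω).fst x + (w : PairSpace Ω).fst x := hx
      rw [this, h, k]
    · filter_upwards [Lp.coeFn_add (v : PairSpace Ω).snd (w : PairSpace Ω).snd, h2, k2]
        with x hx h k
      have : ((v + w : H1 Ω) : PairSpace Ω).snd x
        = (v : PairSpace Ω).snd x + (w : PairSpace Ω).snd x := hx
      rw [this, h, k]
      simp only [gradient]
      rw [fderiv_fun_add (hφ.differentiable (by simp) x) (hψ.differentiable (by simp) x), map_add]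
  smul_mem' := by
    rintro c v ⟨φ, hφ, h0, h1, h2⟩
    refine ⟨fun x => c * φ x, contDiff_const.mul hφ, fun x hx => by simp [h0 x hx], ?_, ?_⟩
    · filter_upwards [Lp.coeFn_smul c (v : PairSpace Ω).fst, h1] with x hx h
      have : ((c • v : H1 Ω) : PairSpace Ω).fst x = c * (v : PairSpace Ω).fst x := hx
      rw [this, h]
    · filter_upwards [Lp.coeFn_smul c (v : PairSpace Ω).snd, h2] with x hx h
      have : ((c • v : H1 Ω) : PairSpace Ω).snd x = c • (v : PairSpace Ω).snd x := hx
      rw [this, h]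
      simp only [gradient]
      rw [fderiv_const_mul (hφ.differentiable (by simp) x)]
      simp

/-- The space `H¹₀(Ω)`: the closure in `H¹(Ω)` of the smooth functions vanishing on `∂Ω`.
It is given its own type because it carries the gradient norm below. -/
def H10 (Ω : Set (EuclideanSpace ℝ (Fin d))) : Type :=
  ↥(smoothZeroBoundary Ω).topologicalClosure

instance (Ω : Set (EuclideanSpace ℝ (Fin d))) : AddCommGroup (H10 Ω) :=
  inferInstanceAs (AddCommGroup ↥(smoothZeroBoundary Ω).topologicalClosure)

instance (Ω : Set (EuclideanSpace ℝ (Fin d))) : Module ℝ (H10 Ω) :=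
  inferInstanceAs (Module ℝ ↥(smoothZeroBoundary Ω).topologicalClosure)

/-- An element of `H¹₀(Ω)` as a pair `(v, ∇v)`. -/
def H10.toPair {Ω : Set (EuclideanSpace ℝ (Fin d))} : H10 Ω →ₗ[ℝ] PairSpace Ω :=
  (H1 Ω).subtype ∘ₗ (smoothZeroBoundary Ω).topologicalClosure.subtype

/-- The underlying function `v ∈ L_2(Ω)` of an element of `H¹₀(Ω)`. -/
def H10.toFun {Ω : Set (EuclideanSpace ℝ (Fin d))} (v : H10 Ω) : LSpace Ω 2 :=
  v.toPair.fst

/-- The weak gradient `∇v ∈ L_2(Ω; ℝ^d)` of an element of `H¹₀(Ω)`. -/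
def H10.grad {Ω : Set (EuclideanSpace ℝ (Fin d))} : H10 Ω →ₗ[ℝ]
    Lp (EuclideanSpace ℝ (Fin d)) 2
      ((volume : Measure (EuclideanSpace ℝ (Fin d))).restrict Ω) where
  toFun v := v.toPair.snd
  map_add' v w := by rw [map_add, WithLp.add_snd]
  map_smul' c v := by rw [map_smul, WithLp.smul_snd, RingHom.id_apply]

/-- `H¹₀(Ω)` is normed by `‖v‖ = ‖ |∇v| ‖_{L_2(Ω)}`.  (On bounded `Ω` this is a norm, equivalent
to the `H¹` norm; only the seminorm structure is needed to form the dual space.) -/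
instance (Ω : Set (EuclideanSpace ℝ (Fin d))) : SeminormedAddCommGroup (H10 Ω) :=
  SeminormedAddCommGroup.induced (H10 Ω) _ H10.grad

instance (Ω : Set (EuclideanSpace ℝ (Fin d))) : NormedSpace ℝ (H10 Ω) :=
  NormedSpace.induced ℝ (H10 Ω) _ H10.grad

/-- The space `H⁻¹(Ω)`: the dual of `H¹₀(Ω)`, with the dual norm. -/
abbrev HNeg1 (Ω : Set (EuclideanSpace ℝ (Fin d))) : Type :=
  StrongDual ℝ (H10 Ω)

/-- `L_p(Ω)` is embedded into `H⁻¹(Ω)` with constant `C`: for `f ∈ L_p(Ω)` the pairing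
`v ↦ ∫_Ω f v` is defined by convergent integrals for all `v ∈ H¹₀(Ω)` and belongs to `H⁻¹(Ω)`,
the resulting linear map `L_p(Ω) → H⁻¹(Ω)` is injective, and `‖f‖_{H⁻¹(Ω)} ≤ C ‖f‖_{L_p(Ω)}`. -/
def EmbedsInHNeg1 (Ω : Set (EuclideanSpace ℝ (Fin d))) (p : ℝ≥0∞) (C : ℝ) : Prop :=
  ∃ J : LSpace Ω p →ₗ[ℝ] HNeg1 Ω,
    (∀ (f : LSpace Ω p) (v : H10 Ω),
      IntegrableOn (fun x => f x * v.toFun x) Ω ∧ J f v = ∫ x in Ω, f x * v.toFun x) ∧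
    Function.Injective J ∧
    ∀ f : LSpace Ω p, ‖J f‖ ≤ C * ‖f‖

/-- The factor `τ / (τ - 1)` for `1 < τ ≤ ∞`, equal to `1` at `τ = ∞`. -/
def dualFactor (τ : ℝ≥0∞) : ℝ :=
  if τ = ⊤ then 1 else τ.toReal / (τ.toReal - 1)

end NegSobolev

end

/-! By Hölder, the pairing with `f` in `L_p` is bounded on `H¹₀` as soon as `‖v‖_q ≤ C ‖∇v‖_2` for
the conjugate exponent `q`, with the same constant (`embedsInHNeg1_of_eLpNorm_le`). Testing against
`C_c^∞(Ω)` gives injectivity.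

The Gagliardo–Nirenberg–Sobolev inequality supplies this bound for compactly supported `C¹`
functions. The generators of `H¹₀` only vanish on `∂Ω`, so they are truncated by a soft threshold:
this yields compact support without increasing the gradient, and Fatou removes the truncation. A
second use of Fatou passes to the closure.

For `d ≥ 3` the exponent `2d/(d-2)` is critical and conjugate to `2d/(d+2)`. For `d = 2` the
inequality is applied from `W^{1,p}` with `p < 2`; its constant grows linearly in `q`, which
produces the factor `τ/(τ-1)`. -/

namespace NegSobolev

open Filter Topology Set
open scoped NNReal

/-! ### The soft threshold -/

/-- The slope of the soft threshold: `0` for `|s| ≤ 1/k`, `1` for `|s| ≥ 2/k`. -/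
noncomputable def thresholdSlope (k s : ℝ) : ℝ := min 1 (max 0 (|s| * k - 1))

/-- A `C¹` function with slope in `[0, 1]` that vanishes near `0` and tends to the identity
as `k → ∞`. -/
noncomputable def softThreshold (k t : ℝ) : ℝ := ∫ s in (0 : ℝ)..t, thresholdSlope k s

theorem continuous_thresholdSlope (k : ℝ) : Continuous (thresholdSlope k) := by
  unfold thresholdSlope; fun_prop

theorem thresholdSlope_nonneg (k s : ℝ) : 0 ≤ thresholdSlope k s :=
  le_min zero_le_one (le_max_left _ _)

theorem norm_thresholdSlope_le_one (k s : ℝ) : ‖thresholdSlope k s‖ ≤ 1 := by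
  rw [Real.norm_of_nonneg (thresholdSlope_nonneg k s)]
  exact min_le_left _ _

theorem hasDerivAt_softThreshold (k t : ℝ) :
    HasDerivAt (softThreshold k) (thresholdSlope k t) t :=
  (continuous_thresholdSlope k).integral_hasStrictDerivAt 0 t |>.hasDerivAt

theorem contDiff_softThreshold (k : ℝ) : ContDiff ℝ 1 (softThreshold k) := by
  rw [contDiff_one_iff_deriv]
  refine ⟨fun t => (hasDerivAt_softThreshold k t).differentiableAt, ?_⟩
  have : deriv (softThreshold k) = thresholdSlope k :=
    funext fun t => (hasDerivAt_softThreshold k t).deriv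
  rw [this]
  exact continuous_thresholdSlope k

theorem softThreshold_eq_zero {k t : ℝ} (hk : 0 ≤ k) (ht : |t| * k ≤ 1) :
    softThreshold k t = 0 := by
  unfold softThreshold
  rw [intervalIntegral.integral_congr (g := fun _ => (0 : ℝ))]
  · simp
  · intro s hs
    have hst : |s| ≤ |t| := by
      simpa using Set.abs_sub_left_of_mem_uIcc hs
    have : |s| * k ≤ 1 := (mul_le_mul_of_nonneg_right hst hk).trans ht
    simp [thresholdSlope, max_eq_left (sub_nonpos.2 this)]

theorem tendsto_softThreshold (t : ℝ) :
    Tendsto (fun n : ℕ => softThreshold n t) atTop (𝓝 t) := by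
  have h : Tendsto (fun n : ℕ => softThreshold n t) atTop (𝓝 (∫ _ in (0 : ℝ)..t, (1 : ℝ))) := by
    refine intervalIntegral.tendsto_integral_filter_of_dominated_convergence (fun _ => 1) ?_ ?_ ?_ ?_
    · exact Eventually.of_forall fun n => (continuous_thresholdSlope n).aestronglyMeasurable
    · exact Eventually.of_forall fun n => Eventually.of_forall fun s _ =>
        norm_thresholdSlope_le_one n s
    · simp
    -- The slopes converge to `1` except at `s = 0`, where they are always `0`.
    · have h0 : ∀ᵐ s : ℝ, s ≠ 0 := by simp [ae_iff, measure_singleton]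
      filter_upwards [h0] with s hs _
      refine tendsto_const_nhds.congr' ?_
      have hlim : Tendsto (fun n : ℕ => |s| * (n : ℝ)) atTop atTop :=
        tendsto_natCast_atTop_atTop.const_mul_atTop (abs_pos.2 hs)
      filter_upwards [hlim.eventually_ge_atTop 2] with n hn
      rw [thresholdSlope, min_eq_left]
      exact le_max_of_le_right (by linarith)
  simpa using h

/-! ### Truncation of functions vanishing on the boundary -/

variable {d : ℕ}

theorem norm_gradient (φ : EuclideanSpace ℝ (Fin d) → ℝ) (x : EuclideanSpace ℝ (Fin d)) :
    ‖gradient φ x‖ = ‖fderiv ℝ φ x‖ := by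
  simp [gradient]

theorem continuous_gradient {φ : EuclideanSpace ℝ (Fin d) → ℝ} (hφ : ContDiff ℝ ∞ φ) :
    Continuous (gradient φ) :=
  (LinearIsometryEquiv.continuous _).comp (hφ.continuous_fderiv (by simp))

/-- Cutting off small values of a function that vanishes on the boundary yields a compactly
supported function. -/
noncomputable def thresholdExtension (Ω : Set (EuclideanSpace ℝ (Fin d)))
    (φ : EuclideanSpace ℝ (Fin d) → ℝ) (k : ℝ) : EuclideanSpace ℝ (Fin d) → ℝ :=
  Ω.indicator fun x => softThreshold k (φ x)

section thresholdExtension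

variable {Ω : Set (EuclideanSpace ℝ (Fin d))} {φ : EuclideanSpace ℝ (Fin d) → ℝ} {k : ℝ}

theorem support_thresholdExtension_subset (hk : 0 ≤ k) :
    Function.support (thresholdExtension Ω φ k) ⊆ closure Ω ∩ {x | 1 ≤ |φ x| * k} := by
  intro x hx
  rw [thresholdExtension, Function.mem_support, Set.indicator_apply_ne_zero] at hx
  refine ⟨subset_closure hx.1, ?_⟩
  by_contra h
  exact hx.2 (softThreshold_eq_zero hk (not_le.1 h).le)

theorem tsupport_thresholdExtension_subset (hφ : Continuous φ) (hk : 0 ≤ k) :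
    tsupport (thresholdExtension Ω φ k) ⊆ closure Ω ∩ {x | 1 ≤ |φ x| * k} :=
  closure_minimal (support_thresholdExtension_subset hk)
    (isClosed_closure.inter (isClosed_le continuous_const (by fun_prop)))

/-- The closed condition `1 ≤ |φ| k` survives on the topological support and excludes the boundary,
where `φ = 0`. -/
theorem tsupport_thresholdExtension_subset_self (hΩ : IsOpen Ω) (hφ : Continuous φ)
    (h0 : ∀ x ∈ frontier Ω, φ x = 0) (hk : 0 ≤ k) :
    tsupport (thresholdExtension Ω φ k) ⊆ Ω := by
  intro x hx
  obtain ⟨h1, h2⟩ := tsupport_thresholdExtension_subset hφ hk hx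
  by_contra h
  have : φ x = 0 := h0 x (by rw [hΩ.frontier_eq]; exact ⟨h1, h⟩)
  simp only [mem_ofPred_eq, this, abs_zero, zero_mul] at h2
  linarith

theorem hasCompactSupport_thresholdExtension (hb : Bornology.IsBounded Ω) (hφ : Continuous φ)
    (hk : 0 ≤ k) : HasCompactSupport (thresholdExtension Ω φ k) :=
  hb.isCompact_closure.of_isClosed_subset (isClosed_tsupport _)
    ((tsupport_thresholdExtension_subset hφ hk).trans inter_subset_left)

theorem thresholdExtension_eventuallyEq (hΩ : IsOpen Ω) {x : EuclideanSpace ℝ (Fin d)}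
    (hx : x ∈ Ω) :
    thresholdExtension Ω φ k =ᶠ[𝓝 x] fun y => softThreshold k (φ y) := by
  filter_upwards [hΩ.mem_nhds hx] with y hy
  simp [thresholdExtension, hy]

/-- Extension by zero creates no singularity: the topological support lies inside the open set `Ω`,
so near each point the function is either a composition of `C¹` maps or zero. -/
theorem contDiff_thresholdExtension (hΩ : IsOpen Ω) (hφ : ContDiff ℝ 1 φ)
    (h0 : ∀ x ∈ frontier Ω, φ x = 0) (hk : 0 ≤ k) :
    ContDiff ℝ 1 (thresholdExtension Ω φ k) := by
  rw [contDiff_iff_contDiffAt]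
  intro x
  by_cases hx : x ∈ tsupport (thresholdExtension Ω φ k)
  · have hxΩ := tsupport_thresholdExtension_subset_self hΩ hφ.continuous h0 hk hx
    exact ((contDiff_softThreshold k).comp hφ).contDiffAt.congr_of_eventuallyEq
      (thresholdExtension_eventuallyEq hΩ hxΩ)
  · exact contDiffAt_const.congr_of_eventuallyEq (notMem_tsupport_iff_eventuallyEq.1 hx)

/-- Chain rule with slope in `[0, 1]`. The bound does not depend on `k`, so it survives the limit.
-/
theorem norm_fderiv_thresholdExtension_le (hΩ : IsOpen Ω) (hφ : ContDiff ℝ 1 φ)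
    (h0 : ∀ x ∈ frontier Ω, φ x = 0) (hk : 0 ≤ k) (x : EuclideanSpace ℝ (Fin d)) :
    ‖fderiv ℝ (thresholdExtension Ω φ k) x‖ ≤ ‖Ω.indicator (gradient φ) x‖ := by
  by_cases hx : x ∈ tsupport (thresholdExtension Ω φ k)
  · have hxΩ := tsupport_thresholdExtension_subset_self hΩ hφ.continuous h0 hk hx
    have hd := (hasDerivAt_softThreshold k (φ x)).comp_hasFDerivAt x
      (hφ.differentiable one_ne_zero x).hasFDerivAt
    rw [(thresholdExtension_eventuallyEq hΩ hxΩ).fderiv_eq]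
    have he : fderiv ℝ (fun y => softThreshold k (φ y)) x = _ := hd.fderiv
    rw [he, norm_smul, indicator_of_mem hxΩ, norm_gradient]
    exact mul_le_of_le_one_left (norm_nonneg _) (norm_thresholdSlope_le_one _ _)
  · rw [image_eq_zero_of_notMem_tsupport (fun h => hx (tsupport_fderiv_subset ℝ h)), norm_zero]
    exact norm_nonneg _

end thresholdExtension

/-! ### From compactly supported functions to `H¹₀(Ω)` -/

/-- A Sobolev inequality for `C¹` functions with compact support in `Ω`. -/
def SobolevInequality (Ω : Set (EuclideanSpace ℝ (Fin d))) (q : ℝ≥0∞) (C : ℝ≥0) : Prop :=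
  ∀ u : EuclideanSpace ℝ (Fin d) → ℝ, ContDiff ℝ 1 u → HasCompactSupport u → tsupport u ⊆ Ω →
    eLpNorm u q volume ≤ C * eLpNorm (fderiv ℝ u) 2 volume

variable {Ω : Set (EuclideanSpace ℝ (Fin d))} {q : ℝ≥0∞} {C : ℝ≥0}

theorem SobolevInequality.eLpNorm_le_of_frontier (hS : SobolevInequality Ω q C) (hΩ : IsOpen Ω)
    (hb : Bornology.IsBounded Ω) {φ : EuclideanSpace ℝ (Fin d) → ℝ} (hφ : ContDiff ℝ 1 φ)
    (h0 : ∀ x ∈ frontier Ω, φ x = 0) :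
    eLpNorm φ q (volume.restrict Ω) ≤ C * eLpNorm (gradient φ) 2 (volume.restrict Ω) := by
  have hk (n : ℕ) : (0 : ℝ) ≤ n := n.cast_nonneg
  have hbound (n : ℕ) : eLpNorm (thresholdExtension Ω φ n) q volume ≤
      C * eLpNorm (gradient φ) 2 (volume.restrict Ω) := by
    refine (hS _ (contDiff_thresholdExtension hΩ hφ h0 (hk n))
      (hasCompactSupport_thresholdExtension hb hφ.continuous (hk n))
      (tsupport_thresholdExtension_subset_self hΩ hφ.continuous h0 (hk n))).trans ?_
    rw [← eLpNorm_indicator_eq_eLpNorm_restrict hΩ.measurableSet]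
    gcongr
    exact eLpNorm_mono (norm_fderiv_thresholdExtension_le hΩ hφ h0 (hk n))
  rw [← eLpNorm_indicator_eq_eLpNorm_restrict hΩ.measurableSet]
  -- Fatou: the truncations converge pointwise to `φ` extended by zero.
  refine (Lp.eLpNorm_lim_le_liminf_eLpNorm (f := fun n : ℕ => thresholdExtension Ω φ n)
    (fun n => (contDiff_thresholdExtension hΩ hφ h0 (hk n)).continuous.aestronglyMeasurable) _
    (Eventually.of_forall fun x => ?_)).trans ?_
  · by_cases hx : x ∈ Ω
    · simpa [thresholdExtension, hx] using tendsto_softThreshold (φ x)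
    · simp [thresholdExtension, hx]
  · refine (liminf_le_liminf (Eventually.of_forall hbound)).trans ?_
    simp

/-- Approximation in `H¹` gives `L_2` convergence of functions and gradients; an a.e. convergent
subsequence and Fatou then bound the `L_q` norm of the limit, although convergence in `L_q` is not
known. -/
theorem SobolevInequality.eLpNorm_toFun_le (hS : SobolevInequality Ω q C) (hΩ : IsOpen Ω)
    (hb : Bornology.IsBounded Ω) (v : H10 Ω) :
    eLpNorm v.toFun q (volume.restrict Ω) ≤ C * ENNReal.ofReal ‖v‖ := by
  obtain ⟨w, hw⟩ := v
  obtain ⟨s, hs, hlim⟩ := mem_closure_iff_seq_limit.1 hw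
  have hlim' : Tendsto (fun n => (s n : PairSpace Ω)) atTop (𝓝 (w : PairSpace Ω)) :=
    (continuous_subtype_val.tendsto _).comp hlim
  have hfst : Tendsto (fun n => (s n : PairSpace Ω).fst) atTop (𝓝 (w : PairSpace Ω).fst) :=
    ((WithLp.prod_continuous_ofLp 2 _ _).fst.tendsto _).comp hlim'
  have hsnd : Tendsto (fun n => (s n : PairSpace Ω).snd) atTop (𝓝 (w : PairSpace Ω).snd) :=
    ((WithLp.prod_continuous_ofLp 2 _ _).snd.tendsto _).comp hlim'
  have hbound (n : ℕ) : eLpNorm (s n : PairSpace Ω).fst q (volume.restrict Ω) ≤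
      C * ENNReal.ofReal ‖(s n : PairSpace Ω).snd‖ := by
    obtain ⟨φ, hφ, h0, h1, h2⟩ := hs n
    rw [eLpNorm_congr_ae h1, ofReal_norm, Lp.enorm_def, eLpNorm_congr_ae h2]
    exact hS.eLpNorm_le_of_frontier hΩ hb (hφ.of_le (by simp)) h0
  obtain ⟨ns, hns, hae⟩ := (tendstoInMeasure_of_tendsto_Lp hfst).exists_seq_tendsto_ae
  refine (Lp.eLpNorm_lim_le_liminf_eLpNorm (fun n => Lp.aestronglyMeasurable _) _ hae).trans ?_
  refine (liminf_le_liminf (Eventually.of_forall fun n => hbound (ns n))).trans ?_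
  have ht : Tendsto (fun n => (C : ℝ≥0∞) * ENNReal.ofReal ‖(s (ns n) : PairSpace Ω).snd‖) atTop
      (𝓝 (C * ENNReal.ofReal ‖(w : PairSpace Ω).snd‖)) :=
    ENNReal.Tendsto.const_mul
      (ENNReal.tendsto_ofReal ((hsnd.comp hns.tendsto_atTop).norm)) (Or.inr ENNReal.coe_ne_top)
  exact ht.liminf_eq.le

/-! ### Test functions in `H¹₀(Ω)` and duality -/

theorem isWeakGradient_gradient {φ : EuclideanSpace ℝ (Fin d) → ℝ} (hφ : ContDiff ℝ ∞ φ) :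
    IsWeakGradient Ω φ (gradient φ) := by
  intro ψ hψ hc hs i
  obtain ⟨h1, h2⟩ := test_deriv hψ hc i
  have hcoord (x : EuclideanSpace ℝ (Fin d)) :
      gradient φ x i = fderiv ℝ φ x (EuclideanSpace.single i 1) := by
    rw [← inner_gradient_left, EuclideanSpace.inner_single_right]
    simp
  simp_rw [hcoord]
  have hz (x : EuclideanSpace ℝ (Fin d)) (hx : x ∉ Ω) : x ∉ tsupport ψ := fun h => hx (hs h)
  -- The test function is supported in `Ω`, so integration by parts over the whole space has no
  -- boundary term.
  rw [setIntegral_eq_integral_of_forall_compl_eq_zero fun x hx => ?_,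
    setIntegral_eq_integral_of_forall_compl_eq_zero fun x hx => ?_]
  · have hφ' : Continuous fun x => fderiv ℝ φ x (EuclideanSpace.single i 1) :=
      (hφ.continuous_fderiv (by simp)).clm_apply continuous_const
    exact integral_mul_fderiv_eq_neg_fderiv_mul_of_integrable
      ((hφ'.mul hψ.continuous).integrable_of_hasCompactSupport hc.mul_left)
      ((hφ.continuous.mul h1).integrable_of_hasCompactSupport h2.mul_left)
      ((hφ.continuous.mul hψ.continuous).integrable_of_hasCompactSupport hc.mul_left)
      (fun x _ => hφ.differentiable (by simp) x) (fun x _ => hψ.differentiable (by simp) x)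
  · rw [image_eq_zero_of_notMem_tsupport (hz x hx), mul_zero]
  · rw [image_eq_zero_of_notMem_tsupport fun h => hz x hx (tsupport_fderiv_subset ℝ h)]
    simp

/-- Test functions on an open set `Ω` represent elements of `H¹₀(Ω)`. -/
theorem exists_H10_of_test (hΩ : IsOpen Ω) {φ : EuclideanSpace ℝ (Fin d) → ℝ}
    (hφ : ContDiff ℝ ∞ φ) (hc : HasCompactSupport φ) (hs : tsupport φ ⊆ Ω) :
    ∃ v : H10 Ω, v.toFun =ᵐ[volume.restrict Ω] φ := by
  have hcg : HasCompactSupport (gradient φ) :=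
    (hc.fderiv (𝕜 := ℝ)).comp_left (g := (InnerProductSpace.toDual ℝ _).symm) (map_zero _)
  have m1 : MemLp φ 2 (volume.restrict Ω) := hφ.continuous.memLp_of_hasCompactSupport hc
  have m2 : MemLp (gradient φ) 2 (volume.restrict Ω) :=
    (continuous_gradient hφ).memLp_of_hasCompactSupport hcg
  let w : PairSpace Ω := WithLp.toLp 2 (m1.toLp φ, m2.toLp (gradient φ))
  have hw1 : w.fst =ᵐ[volume.restrict Ω] φ := m1.coeFn_toLp
  have hw2 : w.snd =ᵐ[volume.restrict Ω] gradient φ := m2.coeFn_toLp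
  have hw : w ∈ H1 Ω := by
    intro ψ hψ hcψ hsψ i
    have := isWeakGradient_gradient (Ω := Ω) hφ ψ hψ hcψ hsψ i
    convert this using 1
    · exact integral_congr_ae (hw1.mono fun x hx => by simp only [hx])
    · congr 1
      exact integral_congr_ae (hw2.mono fun x hx => by simp only [hx])
  have hw0 : (⟨w, hw⟩ : H1 Ω) ∈ smoothZeroBoundary Ω := by
    refine ⟨φ, hφ, fun x hx => image_eq_zero_of_notMem_tsupport fun h => ?_, hw1, hw2⟩
    rw [hΩ.frontier_eq] at hx
    exact hx.2 (hs h)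
  exact ⟨⟨⟨w, hw⟩, (smoothZeroBoundary Ω).le_topologicalClosure hw0⟩, hw1⟩

theorem H10.coeFn_toFun_add (v w : H10 Ω) :
    (v + w).toFun =ᵐ[volume.restrict Ω] fun x => v.toFun x + w.toFun x :=
  Lp.coeFn_add v.toFun w.toFun

theorem H10.coeFn_toFun_smul (c : ℝ) (v : H10 Ω) :
    (c • v).toFun =ᵐ[volume.restrict Ω] fun x => c * v.toFun x := by
  have h : (c • v).toFun = c • v.toFun := by
    rw [H10.toFun, map_smul, WithLp.smul_fst, H10.toFun]
  rw [h]
  exact Lp.coeFn_smul c v.toFun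

theorem eLpNorm_mul_le {p : ℝ≥0∞} [hpq : p.HolderConjugate q] {f g : EuclideanSpace ℝ (Fin d) → ℝ}
    {μ : Measure (EuclideanSpace ℝ (Fin d))}
    (hf : AEStronglyMeasurable f μ) (hg : AEStronglyMeasurable g μ) :
    eLpNorm (fun x => f x * g x) 1 μ ≤ eLpNorm f p μ * eLpNorm g q μ := by
  refine (eLpNorm_le_eLpNorm_mul_eLpNorm_of_nnnorm (p := p) (q := q) (r := 1) (hpqr := hpq) hf hg
    (· * ·) 1 (.of_forall fun x => ?_)).trans_eq ?_
  · rw [one_mul, nnnorm_mul]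
  · rw [ENNReal.coe_one, one_mul]

/-- If the functions of `H¹₀(Ω)` obey a Sobolev inequality in `L_q(Ω)`, then the dual exponent
embeds into `H⁻¹(Ω)` with the same constant. -/
theorem embedsInHNeg1_of_eLpNorm_le {p : ℝ≥0∞} [p.HolderConjugate q] (hΩ : IsOpen Ω)
    (hb : Bornology.IsBounded Ω)
    (hv : ∀ v : H10 Ω, eLpNorm v.toFun q (volume.restrict Ω) ≤ C * ENNReal.ofReal ‖v‖) :
    EmbedsInHNeg1 Ω p C := by
  have : IsFiniteMeasure ((volume : Measure (EuclideanSpace ℝ (Fin d))).restrict Ω) :=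
    isFiniteMeasure_restrict.2 hb.measure_lt_top.ne
  have hp : 1 ≤ p := ENNReal.HolderConjugate.one_le p q
  have hf0 (f : LSpace Ω p) : 0 ≤ ‖f‖ := ENNReal.toReal_nonneg
  have hfe (f : LSpace Ω p) : ENNReal.ofReal ‖f‖ = eLpNorm f p (volume.restrict Ω) := by
    rw [Lp.norm_def, ENNReal.ofReal_toReal (Lp.eLpNorm_ne_top f)]
  have hmul (f : LSpace Ω p) (v : H10 Ω) :
      eLpNorm (fun x => f x * v.toFun x) 1 (volume.restrict Ω)
        ≤ ENNReal.ofReal (C * ‖f‖ * ‖v‖) := by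
    refine (eLpNorm_mul_le (p := p) (q := q) (Lp.aestronglyMeasurable f)
      (Lp.aestronglyMeasurable _)).trans ?_
    rw [mul_comm (C : ℝ), mul_assoc, ENNReal.ofReal_mul (hf0 f), hfe,
      ENNReal.ofReal_mul C.coe_nonneg, ENNReal.ofReal_coe_nnreal]
    gcongr
    exact hv v
  have hint (f : LSpace Ω p) (v : H10 Ω) : IntegrableOn (fun x => f x * v.toFun x) Ω :=
    memLp_one_iff_integrable.1
      ⟨(Lp.aestronglyMeasurable f).mul (Lp.aestronglyMeasurable _),
        (hmul f v).trans_lt ENNReal.ofReal_lt_top⟩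
  have hnorm (f : LSpace Ω p) (v : H10 Ω) :
      ‖∫ x in Ω, f x * v.toFun x‖ ≤ C * ‖f‖ * ‖v‖ := by
    refine (norm_integral_le_lintegral_norm _).trans (ENNReal.toReal_le_of_le_ofReal
      (mul_nonneg (mul_nonneg C.coe_nonneg (hf0 f)) (norm_nonneg _)) ?_)
    simpa only [eLpNorm_one_eq_lintegral_enorm, ofReal_norm] using hmul f v
  let T (f : LSpace Ω p) : HNeg1 Ω := LinearMap.mkContinuous
    { toFun := fun v => ∫ x in Ω, f x * v.toFun x
      map_add' := fun v w => by
        rw [← integral_add (hint f v) (hint f w)]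
        exact integral_congr_ae ((H10.coeFn_toFun_add v w).mono fun x hx => by
          simp only [hx, mul_add])
      map_smul' := fun c v => by
        rw [RingHom.id_apply, smul_eq_mul, ← integral_const_mul]
        exact integral_congr_ae ((H10.coeFn_toFun_smul c v).mono fun x hx => by
          simp only [hx]; ring) }
    (C * ‖f‖) (hnorm f)
  have hT (f : LSpace Ω p) (v : H10 Ω) : T f v = ∫ x in Ω, f x * v.toFun x := rfl
  let J : LSpace Ω p →ₗ[ℝ] HNeg1 Ω :=
    { toFun := T
      map_add' := fun f g => by
        ext v
        rw [add_apply, hT, hT, hT, ← integral_add (hint f v) (hint g v)]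
        exact integral_congr_ae ((Lp.coeFn_add f g).mono fun x hx => by
          simp only [hx, Pi.add_apply, add_mul])
      map_smul' := fun c f => by
        ext v
        rw [RingHom.id_apply, smul_apply, hT, hT, smul_eq_mul,
          ← integral_const_mul]
        exact integral_congr_ae ((Lp.coeFn_smul c f).mono fun x hx => by
          simp only [hx, Pi.smul_apply, smul_eq_mul, mul_assoc]) }
  refine ⟨J, fun f v => ⟨hint f v, rfl⟩, ?_, fun f =>
    LinearMap.mkContinuous_norm_le _ (mul_nonneg C.coe_nonneg (hf0 f)) (hnorm f)⟩
  refine (injective_iff_map_eq_zero J).2 fun f hf => ?_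
  have hloc : LocallyIntegrableOn f Ω volume :=
    IntegrableOn.locallyIntegrableOn ((Lp.memLp f).integrable hp)
  -- Fundamental lemma of the calculus of variations: `f` annihilates every test function, since
  -- each represents an element of `H¹₀(Ω)`.
  have hae : ∀ᵐ x ∂volume, x ∈ Ω → f x = 0 := by
    refine hΩ.ae_eq_zero_of_integral_contDiff_smul_eq_zero hloc fun φ hφ hc hs => ?_
    obtain ⟨v, hvφ⟩ := exists_H10_of_test hΩ hφ hc hs
    have h0 : ∫ x in Ω, f x * v.toFun x = 0 := by
      change J f v = 0
      rw [hf, zero_apply]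
    rw [← setIntegral_eq_integral_of_forall_compl_eq_zero (s := Ω) fun x hx => by
      rw [image_eq_zero_of_notMem_tsupport fun h => hx (hs h), zero_smul], ← h0]
    exact integral_congr_ae (hvφ.mono fun x hx => by simp only [hx, smul_eq_mul, mul_comm])
  rw [Lp.eq_zero_iff_ae_eq_zero]
  exact (ae_restrict_iff' hΩ.measurableSet).2 hae

/-! ### The unit cube and its Sobolev inequalities -/

theorem unitCube_eq_preimage (d : ℕ) :
    unitCube d = WithLp.ofLp ⁻¹' Set.pi univ fun _ : Fin d => Ioo (0 : ℝ) 1 := by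
  ext x
  simp [unitCube]

theorem isOpen_unitCube (d : ℕ) : IsOpen (unitCube d) := by
  rw [unitCube_eq_preimage]
  exact (isOpen_set_pi finite_univ fun _ _ => isOpen_Ioo).preimage (PiLp.continuous_ofLp 2 _)

theorem volume_unitCube (d : ℕ) : volume (unitCube d) = 1 := by
  rw [unitCube_eq_preimage, (PiLp.volume_preserving_ofLp (Fin d)).measure_preimage
    (MeasurableSet.univ_pi fun _ => measurableSet_Ioo).nullMeasurableSet, volume_pi_pi]
  simp

theorem isBounded_unitCube (d : ℕ) : Bornology.IsBounded (unitCube d) := by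
  rw [unitCube_eq_preimage]
  exact (PiLp.antilipschitzWith_ofLp 2 _).isBounded_preimage
    (Bornology.IsBounded.pi fun _ => Metric.isBounded_Ioo 0 1)

/-- The Sobolev inequality with the critical exponent `2d / (d - 2)`. -/
theorem sobolevInequality_critical (hd : 3 ≤ d) :
    ∃ C : ℝ≥0, SobolevInequality (unitCube d) (ENNReal.ofReal (2 * d / (d - 2))) C := by
  refine ⟨eLpNormLESNormFDerivOfEqInnerConst
    (volume : Measure (EuclideanSpace ℝ (Fin d))) (2 : ℝ≥0), fun u hu hc _ => ?_⟩
  have hd' : (3 : ℝ) ≤ d := by exact_mod_cast hd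
  refine eLpNorm_le_eLpNorm_fderiv_of_eq_inner (p := 2) volume hu hc one_le_two ?_ ?_
  · rw [finrank_euclideanSpace_fin]; omega
  · rw [Real.coe_toNNReal _ (div_nonneg (by positivity) (by linarith)), finrank_euclideanSpace_fin]
    have : (d : ℝ) - 2 ≠ 0 := by linarith
    push_cast
    field_simp

/-- In the plane, the constant of the Sobolev inequality grows at most linearly in the
exponent. -/
theorem sobolevInequality_plane :
    ∃ C : ℝ≥0, ∀ q : ℝ≥0, 2 ≤ q → SobolevInequality (unitCube 2) q (C * q) := by
  refine ⟨eLpNormLESNormFDerivOneConst (volume : Measure (EuclideanSpace ℝ (Fin 2)))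
    (NNReal.conjExponent 2), fun q hq u hu hc hs => ?_⟩
  have hq' : (2 : ℝ) ≤ q := by exact_mod_cast hq
  -- The exponent whose planar Sobolev conjugate is `q`: `1/q = 1/p - 1/2`. The condition `2 ≤ q` is
  -- what makes `1 ≤ p`.
  let p : ℝ≥0 := 2 * q / (q + 2)
  have hpc : (p : ℝ) = 2 * q / (q + 2) := by simp [p]
  have hp1 : 1 ≤ p := by
    rw [← NNReal.coe_le_coe, hpc, NNReal.coe_one, le_div_iff₀ (by positivity)]
    linarith
  have hp2 : p ≤ 2 := by
    rw [← NNReal.coe_le_coe, hpc, div_le_iff₀ (by positivity)]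
    push_cast
    linarith
  have h := eLpNorm_le_eLpNorm_fderiv_of_eq_inner (p := p) (p' := q) volume hu hc hp1
    (by simp) (by rw [NNReal.coe_inv, hpc, finrank_euclideanSpace_fin]; push_cast; field_simp; ring)
  refine h.trans (mul_le_mul' ?_ ?_)
  · rw [ENNReal.coe_le_coe, eLpNormLESNormFDerivOfEqInnerConst, finrank_euclideanSpace_fin]
    simp only [Nat.cast_ofNat]
    gcongr
    -- The `p`-dependent factor of the constant is `p / (2 - p) = q / 2`, hence at most `q`.
    rw [Real.toNNReal_le_iff_le_coe, hpc, div_le_iff₀]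
    · field_simp
      nlinarith
    · rw [sub_pos, div_lt_iff₀ (by positivity)]
      linarith
  -- The derivative is supported in the cube, which has measure `1`, so its `L_p` norm is at most
  -- its `L_2` norm.
  · have hr (r : ℝ≥0∞) : eLpNorm (fderiv ℝ u) r (volume.restrict (unitCube 2)) =
        eLpNorm (fderiv ℝ u) r volume := by
      rw [← eLpNorm_norm, ← eLpNorm_norm (fderiv ℝ u)]
      exact eLpNorm_restrict_eq_of_support_subset fun x hx =>
        hs (tsupport_fderiv_subset ℝ (subset_tsupport _ (norm_ne_zero_iff.1 hx)))
    have : IsProbabilityMeasure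
        ((volume : Measure (EuclideanSpace ℝ (Fin 2))).restrict (unitCube 2)) :=
      ⟨by rw [Measure.restrict_apply_univ, volume_unitCube]⟩
    rw [← hr, ← hr]
    exact eLpNorm_le_eLpNorm_of_exponent_le (by exact_mod_cast hp2)
      (hu.continuous_fderiv one_ne_zero).aestronglyMeasurable

/-! ### The two embeddings -/

theorem embedsInHNeg1_unitCube_critical (hd : 3 ≤ d) :
    ∃ C : ℝ, 0 < C ∧ EmbedsInHNeg1 (unitCube d) (ENNReal.ofReal (2 * d / (d + 2))) C := by
  obtain ⟨C, hC⟩ := sobolevInequality_critical hd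
  have hd' : (3 : ℝ) ≤ d := by exact_mod_cast hd
  have hd2 : (d : ℝ) - 2 ≠ 0 := by linarith
  have hconj : (2 * (d : ℝ) / (d + 2)).HolderConjugate (2 * d / (d - 2)) := by
    rw [Real.holderConjugate_iff]
    refine ⟨by rw [lt_div_iff₀] <;> linarith, ?_⟩
    field_simp
    ring
  have := hconj.ennrealOfReal
  -- `C + 1` because the Sobolev constant is not known to be positive.
  refine ⟨(C + 1 : ℝ≥0), by positivity, embedsInHNeg1_of_eLpNorm_le
    (q := ENNReal.ofReal (2 * d / (d - 2))) (isOpen_unitCube d) (isBounded_unitCube d) fun v => ?_⟩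
  refine (hC.eLpNorm_toFun_le (isOpen_unitCube d) (isBounded_unitCube d) v).trans ?_
  gcongr
  simp

/-- The factor `τ / (τ - 1)` is the exponent dual to `τ`. -/
theorem exists_holderConjugate_dualFactor {τ : ℝ≥0∞} (hτ : 1 < τ) :
    ∃ r : ℝ≥0, 1 ≤ r ∧ (r : ℝ) = dualFactor τ ∧ τ.HolderConjugate r := by
  by_cases h : τ = ⊤
  · exact ⟨1, le_rfl, by simp [dualFactor, h], by
      subst h; exact ENNReal.holderConjugate_iff.2 (by simp)⟩
  · lift τ to ℝ≥0 using h
    have hτ' : 1 < τ := by exact_mod_cast hτ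
    have hc : τ.HolderConjugate (NNReal.conjExponent τ) := .conjExponent hτ'
    refine ⟨NNReal.conjExponent τ, hc.symm.lt.le, ?_, hc.coe_ennreal⟩
    rw [hc.coe.conjugate_eq]
    simp [dualFactor]

theorem embedsInHNeg1_unitCube_plane :
    ∃ C : ℝ, 0 < C ∧ ∀ τ : ℝ≥0∞, 1 < τ → EmbedsInHNeg1 (unitCube 2) τ (C * dualFactor τ) := by
  obtain ⟨C, hC⟩ := sobolevInequality_plane
  refine ⟨(2 * (C + 1) : ℝ≥0), by positivity, fun τ hτ => ?_⟩
  obtain ⟨r, hr1, hr, hconj⟩ := exists_holderConjugate_dualFactor hτ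
  have : IsProbabilityMeasure
      ((volume : Measure (EuclideanSpace ℝ (Fin 2))).restrict (unitCube 2)) :=
    ⟨by rw [Measure.restrict_apply_univ, volume_unitCube]⟩
  rw [← hr, ← NNReal.coe_mul]
  refine embedsInHNeg1_of_eLpNorm_le (q := r) (isOpen_unitCube 2) (isBounded_unitCube 2) fun v => ?_
  -- The dual exponent `r` can lie in `[1, 2)`, where the planar inequality is not available; `2r ≥
  -- 2` always works and costs only a factor `2`.
  refine (eLpNorm_le_eLpNorm_of_exponent_le (q := (2 * r : ℝ≥0))
    (ENNReal.coe_le_coe.2 (le_mul_of_one_le_left' one_le_two))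
    (Lp.aestronglyMeasurable _)).trans ?_
  refine ((hC (2 * r) (le_mul_of_one_le_right' hr1)).eLpNorm_toFun_le
    (isOpen_unitCube 2) (isBounded_unitCube 2) v).trans ?_
  refine mul_le_mul_left (ENNReal.coe_le_coe.2 ?_) _
  calc C * (2 * r) ≤ (C + 1) * (2 * r) := by gcongr; simp
    _ = 2 * (C + 1) * r := by ring

end NegSobolev

theorem lemma10p5 :
    (∀ d : ℕ, 3 ≤ d → ∃ C : ℝ, 0 < C ∧
      NegSobolev.EmbedsInHNeg1 (NegSobolev.unitCube d)
        (ENNReal.ofReal (2 * (d : ℝ) / ((d : ℝ) + 2))) C) ∧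
    (∃ C : ℝ, 0 < C ∧ ∀ τ : ℝ≥0∞, 1 < τ →
      NegSobolev.EmbedsInHNeg1 (NegSobolev.unitCube 2) τ
        (C * NegSobolev.dualFactor τ)) :=
  ⟨fun _ hd => NegSobolev.embedsInHNeg1_unitCube_critical hd,
    NegSobolev.embedsInHNeg1_unitCube_plane⟩
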